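/- Notation. The Euler numbers $E_n$ are the integers defined by $\sec z=\sum_{n\ge 0}E_n\frac{z^n}{n!}$. For a prime $p$, an integer $\ell$ and real numbers $0\le x<y\le 1$ let \[ S_\ell(x,y)=\sum_{xp<s<yp}s^\ell \bmod p , \] the sum being over integers $s$ (for $\ell<0$, $s^{\ell}$ is the inverse power modulo $p$). The cost of a linear combination of $S_\ell(x_1,y_1),\dots,S_\ell(x_m,y_m)$ is $p\sum_{i=1}^m(y_i-x_i)$. Part 1. Let $p\ge 5$ be a prime and let $k\ge 1$ be an integer with $2k\le p-3$ and $p\nmid 9^k+1$. Put $t=p-1-2k$. Then \[ (-1)^k4^{k-1}(9^k+1)E_t\equiv 2^t\left(S_t(0,\tfrac1{12})-S_t(\tfrac5{12},\tfrac12)\right)\pmod p \] and \[ \begin{aligned} &(-1)^k4^{k-1}(9^k+1)E_t\equiv\\ &\quad 256^t S_t(0,\frac{1}{1536}) -24^t S_t(\frac{5}{144},\frac{11}{288}) -36^t S_t(\frac{61}{432},\frac{31}{216})\\ &\quad -(6^t-12^t) S_t(\frac{11}{72},\frac{133}{864}) -(6^t-12^t+72^t) S_t(\frac{133}{864},\frac{67}{432})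 -(6^t-12^t) S_t(\frac{67}{432},\frac{17}{108})\\ &\quad -(6^t-12^t+18^t) S_t(\frac{17}{108},\frac{205}{1296}) -(6^t-12^t+18^t+108^t) S_t(\frac{205}{1296},\frac{103}{648}) -(6^t-12^t+18^t) S_t(\frac{103}{648},\frac{23}{144})\\ &\quad -(6^t-12^t+18^t-24^t) S_t(\frac{23}{144},\frac{35}{216}) -(6^t-12^t+18^t-24^t) S_t(\frac{37}{216},\frac{25}{144}) -(6^t-12^t+18^t) S_t(\frac{25}{144},\frac{113}{648})\\ &\quad -(6^t-12^t+18^t+108^t) S_t(\frac{113}{648},\frac{227}{1296}) -(6^t-12^t+18^t) S_t(\frac{227}{1296},\frac{19}{108}) -(6^t-12^t) S_t(\frac{19}{108},\frac{77}{432})\\ &\quad -(6^t-12^t+72^t) S_t(\frac{77}{432},\frac{155}{864}) -(6^t-12^t) S_t(\frac{155}{864},\frac{13}{72}) -6^t S_t(\frac{13}{72},\frac{41}{216})\\ &\quad -(6^t+36^t) S_t(\frac{41}{216},\frac{83}{432}) -6^t S_t(\frac{83}{432},\frac{7}{36}) -(2^t-4^t+6^t-8^t-12^t) S_t(\frac{35}{72},\frac{421}{864})\\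 &\quad -(2^t-4^t+6^t-8^t-12^t+72^t) S_t(\frac{421}{864},\frac{211}{432}) -(2^t-4^t+6^t-8^t-12^t) S_t(\frac{211}{432},\frac{47}{96}) -(2^t-4^t+6^t-8^t-16^t-12^t) S_t(\frac{47}{96},\frac{53}{108})\\ &\quad -(2^t-4^t+6^t-8^t-16^t-12^t+18^t) S_t(\frac{53}{108},\frac{637}{1296}) -(2^t-4^t+6^t-8^t-16^t-12^t+18^t+108^t) S_t(\frac{637}{1296},\frac{319}{648}) -(2^t-4^t+6^t-8^t-12^t-16^t+18^t) S_t(\frac{319}{648},\frac{71}{144})\\ &\quad -(2^t-4^t+6^t-8^t-16^t-12^t+18^t-24^t) S_t(\frac{71}{144},\frac{95}{192}) -(2^t-4^t+6^t-8^t-12^t-16^t+18^t-24^t-32^t) S_t(\frac{95}{192},\frac{107}{216}) -(2^t-4^t-8^t-16^t-32^t) S_t(\frac{107}{216},\frac{191}{384})\\ &\quad -(2^t-4^t-8^t-16^t-32^t-64^t) S_t(\frac{191}{384},\frac{383}{768}) -(2^t-4^t-8^t-16^t-32^t-64^t-128^t) S_t(\frac{383}{768},\frac{767}{1536}) -(2^t-4^t-8^t-16^t-32^t-64^t-128^t-256^t)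 S_t(\frac{767}{1536},\frac{1}{2}) \pmod p . \end{aligned} \] The right side of the second congruence is a combination of $33$ sums with cost $\frac{27p}{512}<\frac{p}{18.96}$. Part 2. For every prime $p\ge 7$, \[ \begin{aligned} &477757440\,E_{p-3}\equiv\\ &\quad -729\,S_{-2}(0,\frac{1}{1536}) +82944\,S_{-2}(\frac{5}{144},\frac{11}{288}) +36864\,S_{-2}(\frac{61}{432},\frac{31}{216}) +995328\,S_{-2}(\frac{11}{72},\frac{133}{864})\\ &\quad +1004544\,S_{-2}(\frac{133}{864},\frac{67}{432}) +995328\,S_{-2}(\frac{67}{432},\frac{17}{108}) +1142784\,S_{-2}(\frac{17}{108},\frac{205}{1296}) +1146880\,S_{-2}(\frac{205}{1296},\frac{103}{648})\\ &\quad +1142784\,S_{-2}(\frac{103}{648},\frac{23}{144}) +1059840\,S_{-2}(\frac{23}{144},\frac{35}{216}) +1059840\,S_{-2}(\frac{37}{216},\frac{25}{144}) +1142784\,S_{-2}(\frac{25}{144},\frac{113}{648})\\ &\quad +1146880\,S_{-2}(\frac{113}{648},\frac{227}{1296}) +1142784\,S_{-2}(\frac{227}{1296},\frac{19}{108}) +995328\,S_{-2}(\frac{19}{108},\frac{77}{432})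 +1004544\,S_{-2}(\frac{77}{432},\frac{155}{864})\\ &\quad +995328\,S_{-2}(\frac{155}{864},\frac{13}{72}) +1327104\,S_{-2}(\frac{13}{72},\frac{41}{216}) +1363968\,S_{-2}(\frac{41}{216},\frac{83}{432}) +1327104\,S_{-2}(\frac{83}{432},\frac{7}{36})\\ &\quad +9206784\,S_{-2}(\frac{35}{72},\frac{421}{864}) +9216000\,S_{-2}(\frac{421}{864},\frac{211}{432}) +9206784\,S_{-2}(\frac{211}{432},\frac{47}{96}) +9020160\,S_{-2}(\frac{47}{96},\frac{53}{108})\\ &\quad +9167616\,S_{-2}(\frac{53}{108},\frac{637}{1296}) +9171712\,S_{-2}(\frac{637}{1296},\frac{319}{648}) +9167616\,S_{-2}(\frac{319}{648},\frac{71}{144}) +9084672\,S_{-2}(\frac{71}{144},\frac{95}{192})\\ &\quad +9038016\,S_{-2}(\frac{95}{192},\frac{107}{216}) +7978176\,S_{-2}(\frac{107}{216},\frac{191}{384}) +7966512\,S_{-2}(\frac{191}{384},\frac{383}{768}) +7963596\,S_{-2}(\frac{383}{768},\frac{767}{1536})\\ &\quad +7962867\,S_{-2}(\frac{767}{1536},\frac{1}{2})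 \pmod p . \end{aligned} \] The right side is again a combination of $33$ sums with cost $\frac{27p}{512}$. -/

import Mathlib

open scoped Nat

/-- The rational number `n! * [z^n] sec z`, where `sec z` is the formal power series `1 / cos z`. -/
noncomputable def secCoeff (n : ℕ) : ℚ :=
  (n ! : ℚ) * PowerSeries.coeff n (PowerSeries.cos ℚ)⁻¹

/-- The numbers `n! * [z^n] sec z` are integers. -/
theorem secCoeff_isInt (n : ℕ) : ∃ m : ℤ, secCoeff n = (m : ℚ) := by
  induction n using Nat.strong_induction_on with
  | _ n ih =>
    have hcos : PowerSeries.constantCoeff (PowerSeries.cos ℚ) ≠ 0 := by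
      rw [← PowerSeries.coeff_zero_eq_constantCoeff_apply]
      simp [PowerSeries.cos]
    have hmul := congrArg (PowerSeries.coeff n)
      (PowerSeries.mul_inv_cancel (PowerSeries.cos ℚ) hcos)
    rw [PowerSeries.coeff_mul, Finset.Nat.sum_antidiagonal_eq_sum_range_succ
      (fun i j => PowerSeries.coeff i (PowerSeries.cos ℚ) *
        PowerSeries.coeff j (PowerSeries.cos ℚ)⁻¹), Finset.sum_range_succ'] at hmul
    have h0 : PowerSeries.coeff 0 (PowerSeries.cos ℚ) = 1 := by simp [PowerSeries.cos]
    have hc : ∀ i : ℕ, ∃ c : ℤ,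
        (i ! : ℚ) * PowerSeries.coeff i (PowerSeries.cos ℚ) = (c : ℚ) := by
      intro i
      have hi : (i ! : ℚ) ≠ 0 := by exact_mod_cast i.factorial_ne_zero
      by_cases he : Even i
      · refine ⟨(-1) ^ (i / 2), ?_⟩
        simp [PowerSeries.cos, he]
        field_simp
      · exact ⟨0, by simp [PowerSeries.cos, he]⟩
    choose c hc using hc
    have hone : ∃ e : ℤ, (n ! : ℚ) * PowerSeries.coeff n (1 : PowerSeries ℚ) = (e : ℚ) := by
      rw [PowerSeries.coeff_one]
      split_ifs with h
      · exact ⟨n !, by simp⟩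
      · exact ⟨0, by simp⟩
    obtain ⟨e, he⟩ := hone
    have hterm : ∀ i ∈ Finset.range n, ∃ m : ℤ,
        (n ! : ℚ) * (PowerSeries.coeff (i + 1) (PowerSeries.cos ℚ) *
          PowerSeries.coeff (n - (i + 1)) (PowerSeries.cos ℚ)⁻¹) = (m : ℚ) := by
      intro i hi
      have hin : i + 1 ≤ n := Finset.mem_range.mp hi
      obtain ⟨m, hm⟩ := ih (n - (i + 1)) (by omega)
      refine ⟨n.choose (i + 1) * c (i + 1) * m, ?_⟩
      have hch : (n ! : ℚ) = n.choose (i + 1) * (i + 1)! * (n - (i + 1))! := by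
        exact_mod_cast (Nat.choose_mul_factorial_mul_factorial hin).symm
      push_cast
      rw [← hm, ← hc, hch, secCoeff]
      ring
    choose! m hm using hterm
    refine ⟨e - ∑ i ∈ Finset.range n, m i, ?_⟩
    push_cast
    rw [← he, ← hmul, mul_add, Finset.mul_sum, Finset.sum_congr rfl hm, h0, secCoeff]
    simp

/-- The Euler numbers `E_n`, defined by `sec z = ∑ E_n z^n / n!`. They are integers, and
`eulerNumber_cast` says that nothing is lost in taking the numerator. -/
noncomputable def eulerNumber (n : ℕ) : ℤ := (secCoeff n).num

theorem eulerNumber_cast (n : ℕ) : (eulerNumber n : ℚ) = secCoeff n := by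
  obtain ⟨m, hm⟩ := secCoeff_isInt n
  simp [eulerNumber, hm]

/-- The interval power sum `S_l(x, y) = ∑_{xp < s < yp} s^l mod p`, over the integers `s` strictly
between `xp` and `yp` (see `mem_powerSum_range`). The exponent `l` may be a negative integer. -/
noncomputable def powerSum (p : ℕ) [Fact p.Prime] (l : ℤ) (x y : ℝ) : ZMod p :=
  ∑ s ∈ Finset.Ioo ⌊x * p⌋ ⌈y * p⌉, (s : ZMod p) ^ l

theorem mem_powerSum_range (p : ℕ) (x y : ℝ) (s : ℤ) :
    s ∈ Finset.Ioo ⌊x * p⌋ ⌈y * p⌉ ↔ x * p < s ∧ (s : ℝ) < y * p := by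
  rw [Finset.mem_Ioo, Int.floor_lt, Int.lt_ceil]

/-- The value modulo `p` of the linear combination `∑ c_i * S_l(x_i, y_i)` that is given by the
list of the triples `(c_i, x_i, y_i)`. -/
noncomputable def combination (p : ℕ) [Fact p.Prime] (l : ℤ)
    (terms : List (ℤ × ℝ × ℝ)) : ZMod p :=
  (terms.map fun u => (u.1 : ZMod p) * powerSum p l u.2.1 u.2.2).sum

/-- The cost `p * ∑ (y_i - x_i)` of the linear combination `∑ c_i * S_l(x_i, y_i)`. -/
noncomputable def cost (p : ℕ) (terms : List (ℤ × ℝ × ℝ)) : ℝ :=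
  p * (terms.map fun u => u.2.2 - u.2.1).sum

/-- The 33 coefficients and intervals of the general congruence, with exponent `t`. -/
noncomputable def eulerTerms (t : ℕ) : List (ℤ × ℝ × ℝ) :=
  [ ((256 ^ t : ℤ), 0, 1 / 1536),
    ((-24 ^ t : ℤ), 5 / 144, 11 / 288),
    ((-36 ^ t : ℤ), 61 / 432, 31 / 216),
    ((-(6 ^ t - 12 ^ t) : ℤ), 11 / 72, 133 / 864),
    ((-(6 ^ t - 12 ^ t + 72 ^ t) : ℤ), 133 / 864, 67 / 432),
    ((-(6 ^ t - 12 ^ t) : ℤ), 67 / 432, 17 / 108),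
    ((-(6 ^ t - 12 ^ t + 18 ^ t) : ℤ), 17 / 108, 205 / 1296),
    ((-(6 ^ t - 12 ^ t + 18 ^ t + 108 ^ t) : ℤ), 205 / 1296, 103 / 648),
    ((-(6 ^ t - 12 ^ t + 18 ^ t) : ℤ), 103 / 648, 23 / 144),
    ((-(6 ^ t - 12 ^ t + 18 ^ t - 24 ^ t) : ℤ), 23 / 144, 35 / 216),
    ((-(6 ^ t - 12 ^ t + 18 ^ t - 24 ^ t) : ℤ), 37 / 216, 25 / 144),
    ((-(6 ^ t - 12 ^ t + 18 ^ t) : ℤ), 25 / 144, 113 / 648),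
    ((-(6 ^ t - 12 ^ t + 18 ^ t + 108 ^ t) : ℤ), 113 / 648, 227 / 1296),
    ((-(6 ^ t - 12 ^ t + 18 ^ t) : ℤ), 227 / 1296, 19 / 108),
    ((-(6 ^ t - 12 ^ t) : ℤ), 19 / 108, 77 / 432),
    ((-(6 ^ t - 12 ^ t + 72 ^ t) : ℤ), 77 / 432, 155 / 864),
    ((-(6 ^ t - 12 ^ t) : ℤ), 155 / 864, 13 / 72),
    ((-6 ^ t : ℤ), 13 / 72, 41 / 216),
    ((-(6 ^ t + 36 ^ t) : ℤ), 41 / 216, 83 / 432),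
    ((-6 ^ t : ℤ), 83 / 432, 7 / 36),
    ((-(2 ^ t - 4 ^ t + 6 ^ t - 8 ^ t - 12 ^ t) : ℤ), 35 / 72, 421 / 864),
    ((-(2 ^ t - 4 ^ t + 6 ^ t - 8 ^ t - 12 ^ t + 72 ^ t) : ℤ), 421 / 864, 211 / 432),
    ((-(2 ^ t - 4 ^ t + 6 ^ t - 8 ^ t - 12 ^ t) : ℤ), 211 / 432, 47 / 96),
    ((-(2 ^ t - 4 ^ t + 6 ^ t - 8 ^ t - 16 ^ t - 12 ^ t) : ℤ), 47 / 96, 53 / 108),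
    ((-(2 ^ t - 4 ^ t + 6 ^ t - 8 ^ t - 16 ^ t - 12 ^ t + 18 ^ t) : ℤ), 53 / 108, 637 / 1296),
    ((-(2 ^ t - 4 ^ t + 6 ^ t - 8 ^ t - 16 ^ t - 12 ^ t + 18 ^ t + 108 ^ t) : ℤ), 637 / 1296, 319 / 648),
    ((-(2 ^ t - 4 ^ t + 6 ^ t - 8 ^ t - 12 ^ t - 16 ^ t + 18 ^ t) : ℤ), 319 / 648, 71 / 144),
    ((-(2 ^ t - 4 ^ t + 6 ^ t - 8 ^ t - 16 ^ t - 12 ^ t + 18 ^ t - 24 ^ t) : ℤ), 71 / 144, 95 / 192),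
    ((-(2 ^ t - 4 ^ t + 6 ^ t - 8 ^ t - 12 ^ t - 16 ^ t + 18 ^ t - 24 ^ t - 32 ^ t) : ℤ), 95 / 192, 107 / 216),
    ((-(2 ^ t - 4 ^ t - 8 ^ t - 16 ^ t - 32 ^ t) : ℤ), 107 / 216, 191 / 384),
    ((-(2 ^ t - 4 ^ t - 8 ^ t - 16 ^ t - 32 ^ t - 64 ^ t) : ℤ), 191 / 384, 383 / 768),
    ((-(2 ^ t - 4 ^ t - 8 ^ t - 16 ^ t - 32 ^ t - 64 ^ t - 128 ^ t) : ℤ), 383 / 768, 767 / 1536),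
    ((-(2 ^ t - 4 ^ t - 8 ^ t - 16 ^ t - 32 ^ t - 64 ^ t - 128 ^ t - 256 ^ t) : ℤ), 767 / 1536, 1 / 2) ]

/-- The 33 coefficients and intervals of the congruence for `E_{p-3}`. -/
noncomputable def eulerTermsVandiver : List (ℤ × ℝ × ℝ) :=
  [ (-729, 0, 1 / 1536),
    (82944, 5 / 144, 11 / 288),
    (36864, 61 / 432, 31 / 216),
    (995328, 11 / 72, 133 / 864),
    (1004544, 133 / 864, 67 / 432),
    (995328, 67 / 432, 17 / 108),
    (1142784, 17 / 108, 205 / 1296),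
    (1146880, 205 / 1296, 103 / 648),
    (1142784, 103 / 648, 23 / 144),
    (1059840, 23 / 144, 35 / 216),
    (1059840, 37 / 216, 25 / 144),
    (1142784, 25 / 144, 113 / 648),
    (1146880, 113 / 648, 227 / 1296),
    (1142784, 227 / 1296, 19 / 108),
    (995328, 19 / 108, 77 / 432),
    (1004544, 77 / 432, 155 / 864),
    (995328, 155 / 864, 13 / 72),
    (1327104, 13 / 72, 41 / 216),
    (1363968, 41 / 216, 83 / 432),
    (1327104, 83 / 432, 7 / 36),
    (9206784, 35 / 72, 421 / 864),
    (9216000, 421 / 864, 211 / 432),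
    (9206784, 211 / 432, 47 / 96),
    (9020160, 47 / 96, 53 / 108),
    (9167616, 53 / 108, 637 / 1296),
    (9171712, 637 / 1296, 319 / 648),
    (9167616, 319 / 648, 71 / 144),
    (9084672, 71 / 144, 95 / 192),
    (9038016, 95 / 192, 107 / 216),
    (7978176, 107 / 216, 191 / 384),
    (7966512, 191 / 384, 383 / 768),
    (7963596, 383 / 768, 767 / 1536),
    (7962867, 767 / 1536, 1 / 2) ]

/-! ### Symmetries and multiplication formulas of interval power sums. -/

section PowerSum

/-! Write P(x) for S_t(0, x), with t even and 0 < t < p - 1. Reflection s ↦ p - s and the vanishing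
of the full power sum give P(1 - x) = -P(x), hence P(1/2) = 0. Sorting by residues modulo 2 and 3
then gives P(x) = 2^t (P(x/2) - P((1-x)/2)) and P(x) = 3^t (P(x/3) + P((1+x)/3) - P((1-x)/3)) at
fractions whose denominator is prime to p (`powerSum_duplication`, `powerSum_triplication`).

The Euler number enters through (e^z + e^(-z)) sech z = 2, read as a functional equation on
polynomials. It telescopes to an alternating sum of even powers, which modulo p is a multiple of
P(1/4) (`signedEuler_eq_powerSum_quarter`). Triplication at 1/4, with 9^k 3^t = 1, trades (9^k + 1)
P(1/4) for P(1/12) + P(5/12), and P(5/12) = -S_t(5/12, 1/2).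

The 33-term form is then formal: `combination_eulerTerms` combines 15 duplications and 14
triplications linearly. The E_{p-3} case is k = 1, with n^(p-3) = n^(-2) and denominators cleared.
-/

theorem div_mul_ne_intCast {p c d : ℕ} (hd : d.Coprime p) (hc : 0 < c) (hcd : c < d) (m : ℤ) :
    (c / d : ℝ) * p ≠ m := by
  intro h
  have hd0 : (d : ℝ) ≠ 0 := by
    have : d ≠ 0 := by omega
    exact_mod_cast this
  rw [div_mul_eq_mul_div, div_eq_iff hd0] at h
  have h' : (c * p : ℤ) = m * d := by exact_mod_cast h
  have hdvd : (d : ℤ) ∣ c :=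
    (Nat.isCoprime_iff_coprime.mpr hd).dvd_of_dvd_mul_right ⟨m, by rw [h', mul_comm]⟩
  exact absurd (Nat.le_of_dvd hc (Int.natCast_dvd_natCast.mp hdvd)) (by omega)

variable {p : ℕ} [Fact p.Prime]

/-- Splitting an interval at a point that is not a multiple of `1 / p`. -/
theorem powerSum_add (l : ℤ) {x y z : ℝ} (hxy : x ≤ y) (hyz : y ≤ z)
    (hy : ∀ m : ℤ, y * p ≠ m) :
    powerSum p l x y + powerSum p l y z = powerSum p l x z := by
  have hp : (0 : ℝ) ≤ p := by positivity
  unfold powerSum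
  rw [← Finset.sum_union]
  · congr 1
    ext s
    simp only [Finset.mem_union, mem_powerSum_range]
    have h1 : x * p ≤ y * p := by gcongr
    have h2 : y * p ≤ z * p := by gcongr
    constructor
    · rintro (h | h)
      · exact ⟨h.1, h.2.trans_le h2⟩
      · exact ⟨h1.trans_lt h.1, h.2⟩
    · rintro ⟨h, h'⟩
      rcases lt_trichotomy (s : ℝ) (y * p) with g | g | g
      · exact Or.inl ⟨h, g⟩
      · exact absurd g.symm (hy s)
      · exact Or.inr ⟨g, h'⟩
  · rw [Finset.disjoint_left]
    intro s h h'
    rw [mem_powerSum_range] at h h'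
    exact absurd (h.2.trans h'.1) (lt_irrefl _)

/-- For an even exponent, the interval power sums are invariant under `x ↦ 1 - x`. -/
theorem powerSum_one_sub {t : ℕ} (ht : Even t) (x y : ℝ) :
    powerSum p t (1 - y) (1 - x) = powerSum p t x y := by
  unfold powerSum
  refine Finset.sum_nbij' (fun s => p - s) (fun s => p - s) ?_ ?_ ?_ ?_ ?_
  · intro s hs
    rw [mem_powerSum_range] at hs ⊢
    push_cast
    constructor <;> nlinarith [hs.1, hs.2]
  · intro s hs
    rw [mem_powerSum_range] at hs ⊢
    push_cast
    constructor <;> nlinarith [hs.1, hs.2]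
  · intro s _; ring
  · intro s _; ring
  · intro s _
    push_cast
    rw [ZMod.natCast_self, zero_sub, zpow_natCast, zpow_natCast, ht.neg_pow]

/-- The integers strictly between 0 and p represent each nonzero residue once, and power sums over a
finite field vanish for exponents below the order of its unit group. -/
theorem powerSum_zero_one {t : ℕ} (ht : 0 < t) (htp : t < p - 1) : powerSum p t 0 1 = 0 := by
  have h := FiniteField.sum_pow_lt_card_sub_one (ZMod p) t (by rwa [ZMod.card])
  rw [← h]
  unfold powerSum
  have hp : 0 < p := (Fact.out : p.Prime).pos
  rw [← Finset.sum_subset (Finset.subset_univ (Finset.univ.erase (0 : ZMod p)))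
    (by intro x _ hx; simp at hx; simp [hx, ht.ne'])]
  refine Finset.sum_bij (fun s _ => (s : ZMod p)) ?_ ?_ ?_ ?_
  · intro s hs
    rw [mem_powerSum_range] at hs
    simp only [zero_mul, one_mul] at hs
    norm_cast at hs
    rw [Finset.mem_erase]
    refine ⟨fun h => ?_, Finset.mem_univ _⟩
    rw [ZMod.intCast_zmod_eq_zero_iff_dvd] at h
    exact absurd (Int.le_of_dvd hs.1 h) (by omega)
  · intro s hs r hr h
    rw [mem_powerSum_range] at hs hr
    simp only [zero_mul, one_mul] at hs hr
    norm_cast at hs hr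
    rw [ZMod.intCast_eq_intCast_iff] at h
    have := h
    rw [Int.ModEq, Int.emod_eq_of_lt hs.1.le hs.2, Int.emod_eq_of_lt hr.1.le hr.2] at this
    exact this
  · intro b hb
    have hb0 : b ≠ 0 := (Finset.mem_erase.mp hb).1
    refine ⟨(b.val : ℤ), ?_, by simp⟩
    rw [mem_powerSum_range]
    simp only [zero_mul, one_mul]
    norm_cast
    exact ⟨Nat.pos_of_ne_zero (by simpa using hb0), b.val_lt⟩
  · intro s _
    rw [zpow_natCast]

/-- The distribution relation: sorting `s` by the residue class of `s` modulo `n`. -/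
theorem powerSum_distribution {n : ℕ} (hn : n.Coprime p) (t : ℕ) (x y : ℝ) :
    powerSum p t x y =
      n ^ t * ∑ j ∈ Finset.range n, powerSum p t ((x + j) / n) ((y + j) / n) := by
  have hn0 : n ≠ 0 := by
    rintro rfl
    exact (Fact.out : p.Prime).one_lt.ne' (by simpa using hn)
  have hnR : (0 : ℝ) < n := by positivity
  have hn' : (0 : ℤ) < n := by positivity
  have hcop : IsCoprime (n : ℤ) p := Nat.isCoprime_iff_coprime.mpr hn
  -- Each s is written as n * r - j * p with 0 ≤ j < n; the bounds on s become bounds on r.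
  have mem : ∀ (j : ℕ) (r : ℤ),
      r ∈ Finset.Ioo ⌊(x + j) / n * p⌋ ⌈(y + j) / n * p⌉ ↔
        (n * r - j * p : ℤ) ∈ Finset.Ioo ⌊x * p⌋ ⌈y * p⌉ := by
    intro j r
    rw [mem_powerSum_range, mem_powerSum_range, div_mul_eq_mul_div, div_mul_eq_mul_div,
      div_lt_iff₀ hnR, lt_div_iff₀ hnR]
    push_cast
    constructor <;> rintro ⟨h1, h2⟩ <;> constructor <;> linarith
  unfold powerSum
  rw [Finset.sum_sigma', Finset.mul_sum]
  symm
  refine Finset.sum_bij (fun (u : (_ : ℕ) × ℤ) _ => (n * u.2 - u.1 * p : ℤ)) ?_ ?_ ?_ ?_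
  · rintro ⟨j, r⟩ h
    rw [Finset.mem_sigma] at h
    exact (mem j r).mp h.2
  · rintro ⟨j, r⟩ h ⟨j', r'⟩ h' e
    rw [Finset.mem_sigma, Finset.mem_range] at h h'
    dsimp only at h h' e
    have hd : (n : ℤ) ∣ (j - j') := by
      refine hcop.dvd_of_dvd_mul_right ⟨r - r', ?_⟩
      linarith
    have hj : (j : ℤ) - j' = 0 := by
      refine Int.eq_zero_of_abs_lt_dvd hd ?_
      rw [abs_lt]
      omega
    have hjj : j = j' := by omega
    subst hjj
    have : (n : ℤ) * r = n * r' := by linarith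
    rw [mul_right_inj' hn'.ne'] at this
    rw [this]
  · intro s hs
    -- With u * n + v * p = 1, the residue j of -s * v modulo n makes s + j * p divisible by n; the
    -- quotient is the r given below.
    obtain ⟨u, v, huv⟩ := hcop
    have hj0 := Int.emod_nonneg (-s * v) hn'.ne'
    have hj1 := Int.emod_lt_of_pos (-s * v) hn'
    obtain ⟨j, hj⟩ := Int.eq_ofNat_of_zero_le hj0
    have hdiv := Int.emod_add_mul_ediv (-s * v) n
    have hs' : s = n * (s * u - p * (-s * v / n)) - j * p := by
      rw [← hj]
      linear_combination (-s) * huv + (p : ℤ) * hdiv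
    refine ⟨⟨j, s * u - p * (-s * v / n)⟩, ?_, hs'.symm⟩
    rw [Finset.mem_sigma, Finset.mem_range]
    refine ⟨by dsimp only; omega, (mem j _).mpr ?_⟩
    rwa [← hs']
  · rintro ⟨j, r⟩ _
    push_cast
    rw [ZMod.natCast_self, mul_zero, sub_zero, zpow_natCast, zpow_natCast, mul_pow]

/-- Split the vanishing sum over (0, 1) at x and reflect the piece (x, 1) onto (0, 1 - x). -/
theorem powerSum_zero_one_sub {t : ℕ} (ht : Even t) (ht0 : 0 < t) (htp : t < p - 1) {x : ℝ}
    (h0 : 0 ≤ x) (h1 : x ≤ 1) (hx : ∀ m : ℤ, x * p ≠ m) :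
    powerSum p t 0 (1 - x) = -powerSum p t 0 x := by
  have h := powerSum_add t h0 h1 hx
  rw [powerSum_zero_one ht0 htp, ← powerSum_one_sub ht x 1, sub_self] at h
  linear_combination h

theorem powerSum_zero_half {t : ℕ} (ht : Even t) (ht0 : 0 < t) (htp : t < p - 1) (hp : p ≠ 2) :
    powerSum p t 0 (1 / 2) = 0 := by
  have h2 : Nat.Coprime 2 p :=
    (Nat.coprime_primes Nat.prime_two Fact.out).mpr hp.symm
  have h := powerSum_zero_one_sub ht ht0 htp (x := 1 / 2) (by norm_num) (by norm_num)
    (by simpa using div_mul_ne_intCast h2 one_pos one_lt_two)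
  rw [show (1 - 1 / 2 : ℝ) = 1 / 2 by norm_num] at h
  have h2' : (2 : ZMod p) ≠ 0 := by
    intro h0
    have : p ∣ 2 := (ZMod.natCast_eq_zero_iff 2 p).mp (by exact_mod_cast h0)
    exact hp ((Nat.prime_dvd_prime_iff_eq Fact.out Nat.prime_two).mp this)
  have h' : (2 : ZMod p) * powerSum p t 0 (1 / 2) = 0 := by linear_combination h
  exact (mul_eq_zero.mp h').resolve_left h2'

/-- Distribution with n = 2 produces S(0, x/2) + S(1/2, (1+x)/2). Since S(0, 1/2) = 0, the second
sum may start at 0, and reflection turns it into -S(0, (1-x)/2). A denominator prime to p keeps the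
cut points off the integers. -/
theorem powerSum_duplication {t : ℕ} (ht : Even t) (ht0 : 0 < t) (htp : t < p - 1) (hp : p ≠ 2)
    {c d : ℕ} (hd : d.Coprime p) (hc : 0 < c) (hcd : c < d) :
    powerSum p t 0 (c / d) = 2 ^ t *
      (powerSum p t 0 (c / d / 2) - powerSum p t 0 ((1 - c / d) / 2)) := by
  have h2 : Nat.Coprime 2 p :=
    (Nat.coprime_primes Nat.prime_two Fact.out).mpr hp.symm
  have hd2 : (d * 2).Coprime p := Nat.Coprime.mul_left hd h2
  have hd0 : (0 : ℝ) < d := by exact_mod_cast (by omega : 0 < d)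
  have hcd' : (c : ℝ) ≤ d := by exact_mod_cast hcd.le
  have hle : (c / d : ℝ) ≤ 1 := (div_le_one hd0).mpr hcd'
  have hnn : (0 : ℝ) ≤ c / d := by positivity
  have hD := powerSum_distribution h2 t 0 (c / d : ℝ) (p := p)
  have hadd := powerSum_add t (p := p) (x := 0) (y := 1 / 2) (z := (c / d + 1) / 2)
    (by norm_num) (by linarith) (by simpa using div_mul_ne_intCast h2 one_pos one_lt_two)
  have hsub := powerSum_zero_one_sub ht ht0 htp (x := (1 - c / d) / 2) (by linarith)
    (by linarith) (by
      have := div_mul_ne_intCast hd2 (c := d - c) (by omega) (by omega)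
      rw [Nat.cast_sub hcd.le] at this
      push_cast at this
      rwa [show ((d : ℝ) - c) / (d * 2) = (1 - c / d) / 2 by field_simp] at this)
  rw [show (1 - (1 - c / d) / 2 : ℝ) = (c / d + 1) / 2 by ring] at hsub
  rw [powerSum_zero_half ht ht0 htp hp] at hadd
  simp only [Finset.sum_range_succ, Finset.sum_range_zero, Nat.cast_zero, Nat.cast_one,
    Nat.cast_ofNat, add_zero, zero_add, zero_div] at hD
  rw [hD]
  linear_combination 2 ^ t * (hadd + hsub)

/-- Distribution with n = 3 gives pieces starting at 0, 1/3 and 2/3. Moving all starts to 0 costs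
S(0, 1/3) + S(0, 2/3) = 0, and the piece ending at (2+x)/3 is reflected. -/
theorem powerSum_triplication {t : ℕ} (ht : Even t) (ht0 : 0 < t) (htp : t < p - 1) (hp : p ≠ 3)
    {c d : ℕ} (hd : d.Coprime p) (hc : 0 < c) (hcd : c < d) :
    powerSum p t 0 (c / d) = 3 ^ t *
      (powerSum p t 0 (c / d / 3) + powerSum p t 0 ((1 + c / d) / 3)
        - powerSum p t 0 ((1 - c / d) / 3)) := by
  have h3 : Nat.Coprime 3 p :=
    (Nat.coprime_primes Nat.prime_three Fact.out).mpr hp.symm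
  have hd3 : (d * 3).Coprime p := Nat.Coprime.mul_left hd h3
  have hd0 : (0 : ℝ) < d := by exact_mod_cast (by omega : 0 < d)
  have hcd' : (c : ℝ) ≤ d := by exact_mod_cast hcd.le
  have hle : (c / d : ℝ) ≤ 1 := (div_le_one hd0).mpr hcd'
  have hnn : (0 : ℝ) ≤ c / d := by positivity
  have hD := powerSum_distribution h3 t 0 (c / d : ℝ) (p := p)
  have n1 : ∀ m : ℤ, (1 / 3 : ℝ) * p ≠ m := by
    simpa using div_mul_ne_intCast h3 one_pos (by norm_num)
  have n2 : ∀ m : ℤ, (2 / 3 : ℝ) * p ≠ m := by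
    simpa using div_mul_ne_intCast h3 two_pos (by norm_num)
  have hadd1 := powerSum_add t (p := p) (x := 0) (y := 1 / 3) (z := (c / d + 1) / 3)
    (by norm_num) (by linarith) n1
  have hadd2 := powerSum_add t (p := p) (x := 0) (y := 2 / 3) (z := (c / d + 2) / 3)
    (by norm_num) (by linarith) n2
  have hthird := powerSum_zero_one_sub ht ht0 htp (x := 1 / 3) (by norm_num) (by norm_num) n1
  have hsub := powerSum_zero_one_sub ht ht0 htp (x := (1 - c / d) / 3) (by linarith)
    (by linarith) (by
      have := div_mul_ne_intCast hd3 (c := d - c) (by omega) (by omega)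
      rw [Nat.cast_sub hcd.le] at this
      push_cast at this
      rwa [show ((d : ℝ) - c) / (d * 3) = (1 - c / d) / 3 by field_simp] at this)
  rw [show (1 - (1 - c / d) / 3 : ℝ) = (c / d + 2) / 3 by ring] at hsub
  rw [show (1 - 1 / 3 : ℝ) = 2 / 3 by norm_num] at hthird
  simp only [Finset.sum_range_succ, Finset.sum_range_zero, Nat.cast_zero, Nat.cast_one,
    Nat.cast_ofNat, add_zero, zero_add, zero_div] at hD
  rw [hD, add_comm 1 (c / d : ℝ)]
  linear_combination 3 ^ t * (hadd1 + hadd2 - hthird + hsub)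

end PowerSum

/-! ### Euler numbers modulo p as quarter-interval power sums. -/

section EulerNumber

/-- The series cos is fixed by z ↦ -z, hence so is its inverse. -/
theorem secCoeff_odd {n : ℕ} (hn : Odd n) : secCoeff n = 0 := by
  have hcos : PowerSeries.constantCoeff (PowerSeries.cos ℚ) ≠ 0 := by
    rw [← PowerSeries.coeff_zero_eq_constantCoeff_apply]
    simp [PowerSeries.cos]
  have hmul := PowerSeries.mul_inv_cancel (PowerSeries.cos ℚ) hcos
  have hev : PowerSeries.rescale (-1 : ℚ) (PowerSeries.cos ℚ) = PowerSeries.cos ℚ := by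
    ext m
    rw [PowerSeries.coeff_rescale]
    by_cases hm : Even m
    · rw [hm.neg_one_pow, one_mul]
    · simp [PowerSeries.cos, hm]
  have hinv : PowerSeries.rescale (-1 : ℚ) (PowerSeries.cos ℚ)⁻¹ = (PowerSeries.cos ℚ)⁻¹ := by
    have h := congrArg (PowerSeries.rescale (-1 : ℚ)) hmul
    rw [map_mul, hev, map_one] at h
    have hne : PowerSeries.cos ℚ ≠ 0 := fun h0 => hcos (by rw [h0, map_zero])
    exact mul_left_cancel₀ hne (h.trans hmul.symm)
  have h := congrArg (PowerSeries.coeff n) hinv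
  rw [PowerSeries.coeff_rescale, hn.neg_one_pow] at h
  have h0 : PowerSeries.coeff n (PowerSeries.cos ℚ)⁻¹ = 0 := by linarith
  rw [secCoeff, h0, mul_zero]

theorem eulerNumber_odd {n : ℕ} (hn : Odd n) : eulerNumber n = 0 := by
  rw [eulerNumber, secCoeff_odd hn, Rat.num_zero]

theorem sum_choose_mul_secCoeff (n : ℕ) :
    ∑ j ∈ Finset.range (n + 1), (n.choose j : ℚ) *
      (if Even (n - j) then (-1) ^ ((n - j) / 2) else 0) * secCoeff j = if n = 0 then 1 else 0 := by
  have hcos : PowerSeries.constantCoeff (PowerSeries.cos ℚ) ≠ 0 := by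
    rw [← PowerSeries.coeff_zero_eq_constantCoeff_apply]
    simp [PowerSeries.cos]
  have hmul := congrArg (PowerSeries.coeff n)
    (PowerSeries.inv_mul_cancel (PowerSeries.cos ℚ) hcos)
  rw [PowerSeries.coeff_mul, Finset.Nat.sum_antidiagonal_eq_sum_range_succ
    (fun i j => PowerSeries.coeff i (PowerSeries.cos ℚ)⁻¹ *
      PowerSeries.coeff j (PowerSeries.cos ℚ))] at hmul
  have hone : (n ! : ℚ) * PowerSeries.coeff n (1 : PowerSeries ℚ) = if n = 0 then 1 else 0 := by
    rw [PowerSeries.coeff_one]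
    split_ifs with h <;> simp [h]
  rw [← hone, ← hmul, Finset.mul_sum]
  refine Finset.sum_congr rfl fun j hj => ?_
  have hjn : j ≤ n := Nat.lt_succ_iff.mp (Finset.mem_range.mp hj)
  have hch : (n ! : ℚ) = n.choose j * j ! * (n - j)! := by
    exact_mod_cast (Nat.choose_mul_factorial_mul_factorial hjn).symm
  have hf : ((n - j)! : ℚ) ≠ 0 := by exact_mod_cast (n - j).factorial_ne_zero
  rw [secCoeff, hch]
  by_cases he : Even (n - j)
  · simp only [PowerSeries.cos, PowerSeries.coeff_mk, he, if_true, eq_ratCast, Rat.cast_id]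
    field_simp
  · simp [PowerSeries.cos, he]

/-- The Euler numbers with their alternating sign, the coefficients of `1 / cosh`. -/
noncomputable def signedEuler (n : ℕ) : ℤ := (-1) ^ (n / 2) * eulerNumber n

theorem signedEuler_odd {n : ℕ} (hn : Odd n) : signedEuler n = 0 := by
  rw [signedEuler, eulerNumber_odd hn, mul_zero]

/-- This is (e^z + e^(-z)) sech z = 2 compared coefficientwise. It is an identity of integers, so it
can be carried into any commutative ring, in particular `ZMod p`. -/
theorem sum_choose_mul_signedEuler (n : ℕ) :
    ∑ j ∈ Finset.range (n + 1), (n.choose j : ℤ) * (1 + (-1) ^ (n - j)) * signedEuler j =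
      if n = 0 then 2 else 0 := by
  have h : ((∑ j ∈ Finset.range (n + 1),
      (n.choose j : ℤ) * (1 + (-1) ^ (n - j)) * signedEuler j : ℤ) : ℚ) =
      (2 * (-1) ^ (n / 2)) * ∑ j ∈ Finset.range (n + 1), (n.choose j : ℚ) *
        (if Even (n - j) then (-1) ^ ((n - j) / 2) else 0) * secCoeff j := by
    push_cast
    rw [Finset.mul_sum]
    refine Finset.sum_congr rfl fun j hj => ?_
    have hjn : j ≤ n := Nat.lt_succ_iff.mp (Finset.mem_range.mp hj)
    rcases Nat.even_or_odd j with hje | hjo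
    · rw [signedEuler]
      push_cast
      rw [eulerNumber_cast]
      by_cases he : Even (n - j)
      · obtain ⟨u, hu⟩ := he
        obtain ⟨v, hv⟩ := hje
        have hn : n / 2 = u + v := by omega
        rw [if_pos ⟨u, hu⟩, hn, show (n - j) / 2 = u by omega, show j / 2 = v by omega, hu,
          pow_add, pow_add]
        have hs : ((-1 : ℚ) ^ u) * (-1) ^ u = 1 := by rw [← mul_pow]; norm_num
        linear_combination (n.choose j * (-1) ^ v * secCoeff j : ℚ) * (-1) * hs
      · rw [if_neg he, (Nat.not_even_iff_odd.mp he).neg_one_pow]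
        ring
    · rw [signedEuler_odd hjo, secCoeff_odd hjo]
      simp
  rw [sum_choose_mul_secCoeff] at h
  have h' : ((if n = 0 then 2 else 0 : ℤ) : ℚ) =
      (2 * (-1) ^ (n / 2)) * (if n = 0 then 1 else 0 : ℚ) := by
    split_ifs with h0 <;> simp [h0]
  exact_mod_cast h.trans h'.symm

open Polynomial in
/-- The linear functional on polynomials that takes `X ^ n` to the signed Euler number `e_n`. -/
noncomputable def eulerFunctional (R : Type*) [CommRing R] : R[X] →ₗ[R] R :=
  Polynomial.lsum fun n => LinearMap.mulRight R (signedEuler n : R)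

open Polynomial in
theorem eulerFunctional_X_pow {R : Type*} [CommRing R] (n : ℕ) :
    eulerFunctional R (X ^ n) = signedEuler n := by
  rw [eulerFunctional, Polynomial.lsum_apply, ← Polynomial.monomial_one_right_eq_X_pow,
    Polynomial.sum_monomial_index]
  · simp
  · simp

open Polynomial in
theorem eulerFunctional_X_add_C_pow {R : Type*} [CommRing R] (n : ℕ) (a : R) :
    eulerFunctional R ((X + C a) ^ n) =
      ∑ j ∈ Finset.range (n + 1), (n.choose j : R) * a ^ (n - j) * signedEuler j := by
  rw [add_pow, map_sum]
  refine Finset.sum_congr rfl fun j _ => ?_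
  have : (X ^ j * C a ^ (n - j) * (n.choose j : R[X])) =
      ((n.choose j : R) * a ^ (n - j)) • (X ^ j : R[X]) := by
    rw [Polynomial.smul_eq_C_mul, C_mul, C_pow]
    simp
    ring
  rw [this, map_smul, eulerFunctional_X_pow, smul_eq_mul]

open Polynomial in
-- On monomials this is the recurrence `sum_choose_mul_signedEuler`; linearity does the rest.
theorem eulerFunctional_shift {R : Type*} [CommRing R] (f : R[X]) :
    eulerFunctional R (f.comp (X + C 1)) + eulerFunctional R (f.comp (X + C (-1))) =
      2 * f.eval 0 := by
  induction f using Polynomial.induction_on' with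
  | add f g hf hg =>
    simp only [add_comp, map_add, eval_add]
    linear_combination hf + hg
  | monomial n a =>
    rw [monomial_comp, monomial_comp, ← smul_eq_C_mul, ← smul_eq_C_mul, map_smul, map_smul,
      eulerFunctional_X_add_C_pow, eulerFunctional_X_add_C_pow, eval_monomial, smul_eq_mul,
      smul_eq_mul, ← mul_add, ← Finset.sum_add_distrib]
    have h := congrArg (Int.cast : ℤ → R) (sum_choose_mul_signedEuler n)
    push_cast at h
    have h' : ∀ j ∈ Finset.range (n + 1),
        (n.choose j : R) * 1 ^ (n - j) * (signedEuler j : R) +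
          (n.choose j : R) * (-1) ^ (n - j) * (signedEuler j : R) =
        (n.choose j : R) * (1 + (-1) ^ (n - j)) * (signedEuler j : R) := by
      intro j _
      rw [one_pow]
      ring
    rw [Finset.sum_congr rfl h', h]
    rcases eq_or_ne n 0 with rfl | hn
    · simp [mul_comm]
    · simp [hn]

open Polynomial in
theorem eulerFunctional_add_one {R : Type*} [CommRing R] (t : ℕ) (x : R) :
    eulerFunctional R ((X + C (x + 1)) ^ t) + eulerFunctional R ((X + C (x - 1)) ^ t) =
      2 * x ^ t := by
  have h := eulerFunctional_shift ((X + C x) ^ t)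
  simp only [pow_comp, add_comp, X_comp, C_comp, eval_pow, eval_add, eval_X, eval_C,
    zero_add] at h
  rw [← h]
  simp only [C_add, C_sub, C_neg, C_1]
  ring_nf

open Polynomial in
theorem eulerFunctional_X_add_one_pow_sub {R : Type*} [CommRing R] {t : ℕ} (ht : Even t) :
    eulerFunctional R ((X + C 1) ^ t) = eulerFunctional R ((X + C (-1)) ^ t) := by
  rw [eulerFunctional_X_add_C_pow, eulerFunctional_X_add_C_pow]
  refine Finset.sum_congr rfl fun j hj => ?_
  have hjn : j ≤ t := Nat.lt_succ_iff.mp (Finset.mem_range.mp hj)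
  rcases Nat.even_or_odd j with hje | hjo
  · rw [((Nat.even_sub hjn).mpr (by simp [ht, hje])).neg_one_pow, one_pow]
  · simp [signedEuler_odd hjo]

/-- The alternating sum is twice its even-indexed part minus the whole sum. -/
theorem sum_alternating_range {R : Type*} [CommRing R] (f : ℕ → R) (h : ℕ) :
    ∑ r ∈ Finset.range h, (-1) ^ (r + 1) * f (r + 1) =
      2 * ∑ r ∈ Finset.range (h / 2), f (2 * (r + 1)) - ∑ r ∈ Finset.range h, f (r + 1) := by
  induction h with
  | zero => simp
  | succ h ih =>
    rw [Finset.sum_range_succ, Finset.sum_range_succ _ h, ih]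
    rcases Nat.even_or_odd h with he | ho
    · rw [show (h + 1) / 2 = h / 2 by obtain ⟨m, hm⟩ := he; omega, he.add_one.neg_one_pow]
      ring
    · obtain ⟨m, hm⟩ := ho
      rw [show (h + 1) / 2 = h / 2 + 1 by omega, Finset.sum_range_succ,
        show 2 * (h / 2 + 1) = h + 1 by omega, (show Even (h + 1) from ⟨m + 1, by
          omega⟩).neg_one_pow]
      ring

variable {p : ℕ} [Fact p.Prime]

open Polynomial in
/-- Euler's evaluation of an alternating power sum, modulo `p`. -/
theorem signedEuler_eq_alternating_sum {t : ℕ} (ht : Even t) (ht0 : 0 < t) (hp : p ≠ 2) :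
    (-1 : ZMod p) ^ ((p - 1) / 2) * signedEuler t =
      2 * ∑ r ∈ Finset.range ((p - 1) / 2), (-1) ^ (r + 1) * (2 * (r + 1) : ZMod p) ^ t := by
  -- Base of the telescoping: at x = 0 the two shifted values are equal for even t and sum to 0.
  have hone : 2 * eulerFunctional (ZMod p) ((X + C 1) ^ t) = 0 := by
    have h := eulerFunctional_add_one t (0 : ZMod p)
    rw [zero_add, zero_sub, ← eulerFunctional_X_add_one_pow_sub ht, zero_pow ht0.ne'] at h
    linear_combination h
  have h2 : (2 : ZMod p) ≠ 0 := by
    intro h0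
    have : p ∣ 2 := (ZMod.natCast_eq_zero_iff 2 p).mp (by exact_mod_cast h0)
    exact hp ((Nat.prime_dvd_prime_iff_eq Fact.out Nat.prime_two).mp this)
  have tel : ∀ h : ℕ, (-1 : ZMod p) ^ h *
      eulerFunctional (ZMod p) ((X + C (2 * h + 1 : ZMod p)) ^ t) =
      2 * ∑ r ∈ Finset.range h, (-1) ^ (r + 1) * (2 * (r + 1) : ZMod p) ^ t := by
    intro h
    induction h with
    | zero => simpa using (mul_eq_zero.mp hone).resolve_left h2
    | succ h ih =>
      rw [Finset.sum_range_succ, mul_add, ← ih]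
      have hs := eulerFunctional_add_one t (2 * (h + 1) : ZMod p)
      rw [show (2 * (h + 1) - 1 : ZMod p) = 2 * h + 1 by ring] at hs
      push_cast
      rw [pow_succ]
      linear_combination (-1) ^ h * (-1) * hs
  have hodd := (Fact.out : p.Prime).odd_of_ne_two hp
  -- After (p - 1) / 2 steps the shift 2h + 1 is p, which is 0, so the functional is evaluated at X
  -- ^ t itself.
  have hcast : (2 * ((p - 1) / 2 : ℕ) + 1 : ZMod p) = 0 := by
    have : 2 * ((p - 1) / 2) + 1 = p := by
      obtain ⟨m, hm⟩ := hodd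
      omega
    have h := congrArg (Nat.cast : ℕ → ZMod p) this
    push_cast at h
    rw [h, ZMod.natCast_self]
  have h := tel ((p - 1) / 2)
  rw [hcast, C_0, add_zero, eulerFunctional_X_pow] at h
  exact h

theorem powerSum_zero_eq_sum_range {t : ℕ} {x : ℝ} {h : ℕ} (h1 : h < x * p)
    (h2 : x * p < h + 1) :
    powerSum p t 0 x = ∑ r ∈ Finset.range h, ((r + 1 : ℕ) : ZMod p) ^ t := by
  unfold powerSum
  symm
  refine Finset.sum_bij (fun r _ => ((r + 1 : ℕ) : ℤ)) ?_ ?_ ?_ ?_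
  · intro r hr
    rw [Finset.mem_range] at hr
    rw [mem_powerSum_range]
    have : ((r + 1 : ℕ) : ℝ) ≤ h := by exact_mod_cast hr
    refine ⟨by rw [zero_mul]; exact_mod_cast r.succ_pos, ?_⟩
    rw [Int.cast_natCast]
    linarith
  · intro r _ s _ h
    simpa using h
  · intro s hs
    rw [mem_powerSum_range, zero_mul] at hs
    have hs0 : 0 < s := by exact_mod_cast hs.1
    have hs1 : s < h + 1 := by exact_mod_cast hs.2.trans h2
    refine ⟨(s - 1).toNat, ?_, ?_⟩
    · rw [Finset.mem_range]; omega
    · push_cast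
      omega
  · intro r _
    simp

/-- In the alternating sum over r < p/2 the full sum is S(0, 1/2) = 0; the even r are twice the
integers below p/4. This yields one factor 2^t, and the even bases 2r yield the other. -/
theorem signedEuler_eq_powerSum_quarter {t : ℕ} (ht : Even t) (ht0 : 0 < t) (htp : t < p - 1)
    (hp : p ≠ 2) :
    (-1 : ZMod p) ^ ((p - 1) / 2) * signedEuler t = 4 * (2 ^ t) ^ 2 * powerSum p t 0 (1 / 4) := by
  obtain ⟨m, hm⟩ := (Fact.out : p.Prime).odd_of_ne_two hp
  have hpm : (p : ℝ) = 2 * m + 1 := by exact_mod_cast hm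
  have hq : powerSum p t 0 (1 / 4) =
      ∑ r ∈ Finset.range (m / 2), ((r + 1 : ℕ) : ZMod p) ^ t := by
    have e := Nat.div_add_mod m 2
    have e' : (2 * (m / 2 : ℕ) + (m % 2 : ℕ) : ℝ) = m := by exact_mod_cast e
    have l : ((m % 2 : ℕ) : ℝ) ≤ 1 := by
      exact_mod_cast Nat.lt_succ_iff.mp (Nat.mod_lt m two_pos)
    have l0 : (0 : ℝ) ≤ ((m % 2 : ℕ) : ℝ) := by positivity
    apply powerSum_zero_eq_sum_range <;> rw [hpm] <;> linarith
  have hh : powerSum p t 0 (1 / 2) = ∑ r ∈ Finset.range m, ((r + 1 : ℕ) : ZMod p) ^ t := by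
    apply powerSum_zero_eq_sum_range <;> rw [hpm] <;> linarith
  rw [powerSum_zero_half ht ht0 htp hp] at hh
  rw [signedEuler_eq_alternating_sum ht ht0 hp, show (p - 1) / 2 = m by omega, hq]
  have halt := sum_alternating_range (fun r => ((r : ℕ) : ZMod p) ^ t) m
  rw [← hh, sub_zero] at halt
  have e1 : ∑ r ∈ Finset.range m, (-1) ^ (r + 1) * (2 * (r + 1) : ZMod p) ^ t =
      2 ^ t * ∑ r ∈ Finset.range m, (-1) ^ (r + 1) * ((r + 1 : ℕ) : ZMod p) ^ t := by
    rw [Finset.mul_sum]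
    refine Finset.sum_congr rfl fun r _ => ?_
    push_cast
    rw [mul_pow]
    ring
  have e2 : ∑ r ∈ Finset.range (m / 2), ((2 * (r + 1) : ℕ) : ZMod p) ^ t =
      2 ^ t * ∑ r ∈ Finset.range (m / 2), ((r + 1 : ℕ) : ZMod p) ^ t := by
    rw [Finset.mul_sum]
    refine Finset.sum_congr rfl fun r _ => ?_
    push_cast
    rw [mul_pow]
  rw [e1, halt, e2]
  ring

end EulerNumber

/-- The exponent 9 is forced by the denominator 1536 = 2^9 * 3. -/
theorem coprime_of_dvd_six_pow {p d : ℕ} (hP : p.Prime) (hp : 5 ≤ p) (hd : d ∣ 6 ^ 9) :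
    d.Coprime p := by
  refine Nat.Coprime.coprime_dvd_left hd (Nat.Coprime.pow_left 9 ?_)
  rw [Nat.coprime_comm, hP.coprime_iff_not_dvd]
  intro h
  rcases (Nat.Prime.dvd_mul hP).mp (show p ∣ 2 * 3 from h) with h | h
  · exact absurd (Nat.le_of_dvd (by norm_num) h) (by omega)
  · exact absurd (Nat.le_of_dvd (by norm_num) h) (by omega)

/-! ### The 33-term identity among interval power sums. -/

section Congruences

variable {p : ℕ} [Fact p.Prime]

theorem powerSum_eq_sub (l : ℤ) {c d c' d' : ℕ} (hd : d.Coprime p) (hc : 0 < c) (hcd : c < d)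
    (hle : (c / d : ℝ) ≤ c' / d') :
    powerSum p l (c / d) (c' / d') = powerSum p l 0 (c' / d') - powerSum p l 0 (c / d) := by
  have h0 : (0 : ℝ) ≤ c / d := by positivity
  rw [← powerSum_add l h0 hle (div_mul_ne_intCast hd hc hcd), add_sub_cancel_left]

theorem combination_eulerTerms (hp : 5 ≤ p) {t : ℕ} (ht : Even t) (ht0 : 0 < t)
    (htp : t < p - 1) :
    combination p t (eulerTerms t) =
      2 ^ t * (powerSum p t 0 (1 / 12) + powerSum p t 0 (5 / 12)) := by
  have D := fun (c d : ℕ) (hd : d ∣ 6 ^ 9) => powerSum_duplication ht ht0 htp (p := p) (by omega)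
    (c := c) (coprime_of_dvd_six_pow Fact.out hp hd)
  have T := fun (c d : ℕ) (hd : d ∣ 6 ^ 9) => powerSum_triplication ht ht0 htp (p := p) (by omega)
    (c := c) (coprime_of_dvd_six_pow Fact.out hp hd)
  have S := fun (c d c' d' : ℕ) (hd : d ∣ 6 ^ 9) => powerSum_eq_sub (p := p) t
    (c := c) (c' := c') (d' := d') (coprime_of_dvd_six_pow Fact.out hp hd)
  have half := powerSum_zero_half ht ht0 htp (p := p) (by omega)
  simp only [combination, eulerTerms, List.map_cons, List.map_nil, List.sum_cons, List.sum_nil]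
  have s_5_144 : powerSum p t (5 / 144) (11 / 288) = powerSum p t 0 (11 / 288) - powerSum p t 0 (5 /
    144) := by
    exact_mod_cast S 5 144 11 288 (by norm_num) (by norm_num) (by norm_num) (by norm_num)
  have s_61_432 : powerSum p t (61 / 432) (31 / 216) = powerSum p t 0 (31 / 216) - powerSum p t 0
    (61 / 432) := by
    exact_mod_cast S 61 432 31 216 (by norm_num) (by norm_num) (by norm_num) (by norm_num)
  have s_11_72 : powerSum p t (11 / 72) (133 / 864) = powerSum p t 0 (133 / 864) - powerSum p t 0
    (11 / 72) := by
    exact_mod_cast S 11 72 133 864 (by norm_num) (by norm_num) (by norm_num) (by norm_num)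
  have s_133_864 : powerSum p t (133 / 864) (67 / 432) = powerSum p t 0 (67 / 432) - powerSum p t 0
    (133 / 864) := by
    exact_mod_cast S 133 864 67 432 (by norm_num) (by norm_num) (by norm_num) (by norm_num)
  have s_67_432 : powerSum p t (67 / 432) (17 / 108) = powerSum p t 0 (17 / 108) - powerSum p t 0
    (67 / 432) := by
    exact_mod_cast S 67 432 17 108 (by norm_num) (by norm_num) (by norm_num) (by norm_num)
  have s_17_108 : powerSum p t (17 / 108) (205 / 1296) = powerSum p t 0 (205 / 1296) - powerSum p t
    0 (17 / 108) := by
    exact_mod_cast S 17 108 205 1296 (by norm_num) (by norm_num) (by norm_num) (by norm_num)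
  have s_205_1296 : powerSum p t (205 / 1296) (103 / 648) = powerSum p t 0 (103 / 648) - powerSum p
    t 0 (205 / 1296) := by
    exact_mod_cast S 205 1296 103 648 (by norm_num) (by norm_num) (by norm_num) (by norm_num)
  have s_103_648 : powerSum p t (103 / 648) (23 / 144) = powerSum p t 0 (23 / 144) - powerSum p t 0
    (103 / 648) := by
    exact_mod_cast S 103 648 23 144 (by norm_num) (by norm_num) (by norm_num) (by norm_num)
  have s_23_144 : powerSum p t (23 / 144) (35 / 216) = powerSum p t 0 (35 / 216) - powerSum p t 0
    (23 / 144) := by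
    exact_mod_cast S 23 144 35 216 (by norm_num) (by norm_num) (by norm_num) (by norm_num)
  have s_37_216 : powerSum p t (37 / 216) (25 / 144) = powerSum p t 0 (25 / 144) - powerSum p t 0
    (37 / 216) := by
    exact_mod_cast S 37 216 25 144 (by norm_num) (by norm_num) (by norm_num) (by norm_num)
  have s_25_144 : powerSum p t (25 / 144) (113 / 648) = powerSum p t 0 (113 / 648) - powerSum p t 0
    (25 / 144) := by
    exact_mod_cast S 25 144 113 648 (by norm_num) (by norm_num) (by norm_num) (by norm_num)
  have s_113_648 : powerSum p t (113 / 648) (227 / 1296) = powerSum p t 0 (227 / 1296) - powerSum p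
    t 0 (113 / 648) := by
    exact_mod_cast S 113 648 227 1296 (by norm_num) (by norm_num) (by norm_num) (by norm_num)
  have s_227_1296 : powerSum p t (227 / 1296) (19 / 108) = powerSum p t 0 (19 / 108) - powerSum p t
    0 (227 / 1296) := by
    exact_mod_cast S 227 1296 19 108 (by norm_num) (by norm_num) (by norm_num) (by norm_num)
  have s_19_108 : powerSum p t (19 / 108) (77 / 432) = powerSum p t 0 (77 / 432) - powerSum p t 0
    (19 / 108) := by
    exact_mod_cast S 19 108 77 432 (by norm_num) (by norm_num) (by norm_num) (by norm_num)
  have s_77_432 : powerSum p t (77 / 432) (155 / 864) = powerSum p t 0 (155 / 864) - powerSum p t 0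
    (77 / 432) := by
    exact_mod_cast S 77 432 155 864 (by norm_num) (by norm_num) (by norm_num) (by norm_num)
  have s_155_864 : powerSum p t (155 / 864) (13 / 72) = powerSum p t 0 (13 / 72) - powerSum p t 0
    (155 / 864) := by
    exact_mod_cast S 155 864 13 72 (by norm_num) (by norm_num) (by norm_num) (by norm_num)
  have s_13_72 : powerSum p t (13 / 72) (41 / 216) = powerSum p t 0 (41 / 216) - powerSum p t 0 (13
    / 72) := by
    exact_mod_cast S 13 72 41 216 (by norm_num) (by norm_num) (by norm_num) (by norm_num)
  have s_41_216 : powerSum p t (41 / 216) (83 / 432) = powerSum p t 0 (83 / 432) - powerSum p t 0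
    (41 / 216) := by
    exact_mod_cast S 41 216 83 432 (by norm_num) (by norm_num) (by norm_num) (by norm_num)
  have s_83_432 : powerSum p t (83 / 432) (7 / 36) = powerSum p t 0 (7 / 36) - powerSum p t 0 (83 /
    432) := by
    exact_mod_cast S 83 432 7 36 (by norm_num) (by norm_num) (by norm_num) (by norm_num)
  have s_35_72 : powerSum p t (35 / 72) (421 / 864) = powerSum p t 0 (421 / 864) - powerSum p t 0
    (35 / 72) := by
    exact_mod_cast S 35 72 421 864 (by norm_num) (by norm_num) (by norm_num) (by norm_num)
  have s_421_864 : powerSum p t (421 / 864) (211 / 432) = powerSum p t 0 (211 / 432) - powerSum p t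
    0 (421 / 864) := by
    exact_mod_cast S 421 864 211 432 (by norm_num) (by norm_num) (by norm_num) (by norm_num)
  have s_211_432 : powerSum p t (211 / 432) (47 / 96) = powerSum p t 0 (47 / 96) - powerSum p t 0
    (211 / 432) := by
    exact_mod_cast S 211 432 47 96 (by norm_num) (by norm_num) (by norm_num) (by norm_num)
  have s_47_96 : powerSum p t (47 / 96) (53 / 108) = powerSum p t 0 (53 / 108) - powerSum p t 0 (47
    / 96) := by
    exact_mod_cast S 47 96 53 108 (by norm_num) (by norm_num) (by norm_num) (by norm_num)
  have s_53_108 : powerSum p t (53 / 108) (637 / 1296) = powerSum p t 0 (637 / 1296) - powerSum p t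
    0 (53 / 108) := by
    exact_mod_cast S 53 108 637 1296 (by norm_num) (by norm_num) (by norm_num) (by norm_num)
  have s_637_1296 : powerSum p t (637 / 1296) (319 / 648) = powerSum p t 0 (319 / 648) - powerSum p
    t 0 (637 / 1296) := by
    exact_mod_cast S 637 1296 319 648 (by norm_num) (by norm_num) (by norm_num) (by norm_num)
  have s_319_648 : powerSum p t (319 / 648) (71 / 144) = powerSum p t 0 (71 / 144) - powerSum p t 0
    (319 / 648) := by
    exact_mod_cast S 319 648 71 144 (by norm_num) (by norm_num) (by norm_num) (by norm_num)
  have s_71_144 : powerSum p t (71 / 144) (95 / 192) = powerSum p t 0 (95 / 192) - powerSum p t 0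
    (71 / 144) := by
    exact_mod_cast S 71 144 95 192 (by norm_num) (by norm_num) (by norm_num) (by norm_num)
  have s_95_192 : powerSum p t (95 / 192) (107 / 216) = powerSum p t 0 (107 / 216) - powerSum p t 0
    (95 / 192) := by
    exact_mod_cast S 95 192 107 216 (by norm_num) (by norm_num) (by norm_num) (by norm_num)
  have s_107_216 : powerSum p t (107 / 216) (191 / 384) = powerSum p t 0 (191 / 384) - powerSum p t
    0 (107 / 216) := by
    exact_mod_cast S 107 216 191 384 (by norm_num) (by norm_num) (by norm_num) (by norm_num)
  have s_191_384 : powerSum p t (191 / 384) (383 / 768) = powerSum p t 0 (383 / 768) - powerSum p t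
    0 (191 / 384) := by
    exact_mod_cast S 191 384 383 768 (by norm_num) (by norm_num) (by norm_num) (by norm_num)
  have s_383_768 : powerSum p t (383 / 768) (767 / 1536) = powerSum p t 0 (767 / 1536) - powerSum p
    t 0 (383 / 768) := by
    exact_mod_cast S 383 768 767 1536 (by norm_num) (by norm_num) (by norm_num) (by norm_num)
  have s_767_1536 : powerSum p t (767 / 1536) (1 / 2) = powerSum p t 0 (1 / 2) - powerSum p t 0 (767
    / 1536) := by
    exact_mod_cast S 767 1536 1 2 (by norm_num) (by norm_num) (by norm_num) (by norm_num)
  rw [s_5_144, s_61_432, s_11_72, s_133_864, s_67_432, s_17_108, s_205_1296, s_103_648, s_23_144,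
    s_37_216, s_25_144, s_113_648, s_227_1296, s_19_108, s_77_432, s_155_864, s_13_72, s_41_216,
    s_83_432, s_35_72, s_421_864, s_211_432, s_47_96, s_53_108, s_637_1296, s_319_648, s_71_144,
    s_95_192, s_107_216, s_191_384, s_383_768, s_767_1536, half]
  clear S half
  clear s_5_144 s_61_432 s_11_72 s_133_864 s_67_432 s_17_108 s_205_1296 s_103_648 s_23_144 s_37_216
    s_25_144 s_113_648 s_227_1296 s_19_108 s_77_432 s_155_864 s_13_72 s_41_216 s_83_432 s_35_72
    s_421_864 s_211_432 s_47_96 s_53_108 s_637_1296 s_319_648 s_71_144 s_95_192 s_107_216 s_191_384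
    s_383_768 s_767_1536
  -- From here only the duplication and triplication relations matter, so P may be an arbitrary
  -- function; all coefficients become polynomials in a = 2^t and b = 3^t.
  generalize powerSum p t 0 = P at *
  push_cast
  have p_4 : (4 : ZMod p) ^ t = (2 ^ t) ^ 2 := by
    rw [show (4 : ZMod p) = 2 ^ 2 by norm_num, pow_right_comm]
  have p_8 : (8 : ZMod p) ^ t = (2 ^ t) ^ 3 := by
    rw [show (8 : ZMod p) = 2 ^ 3 by norm_num, pow_right_comm]
  have p_16 : (16 : ZMod p) ^ t = (2 ^ t) ^ 4 := by
    rw [show (16 : ZMod p) = 2 ^ 4 by norm_num, pow_right_comm]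
  have p_32 : (32 : ZMod p) ^ t = (2 ^ t) ^ 5 := by
    rw [show (32 : ZMod p) = 2 ^ 5 by norm_num, pow_right_comm]
  have p_64 : (64 : ZMod p) ^ t = (2 ^ t) ^ 6 := by
    rw [show (64 : ZMod p) = 2 ^ 6 by norm_num, pow_right_comm]
  have p_128 : (128 : ZMod p) ^ t = (2 ^ t) ^ 7 := by
    rw [show (128 : ZMod p) = 2 ^ 7 by norm_num, pow_right_comm]
  have p_256 : (256 : ZMod p) ^ t = (2 ^ t) ^ 8 := by
    rw [show (256 : ZMod p) = 2 ^ 8 by norm_num, pow_right_comm]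
  have p_6 : (6 : ZMod p) ^ t = (2 ^ t) ^ 1 * (3 ^ t) ^ 1 := by
    rw [show (6 : ZMod p) = 2 ^ 1 * 3 ^ 1 by norm_num, mul_pow, pow_right_comm (2 : ZMod p),
      pow_right_comm (3 : ZMod p)]
  have p_12 : (12 : ZMod p) ^ t = (2 ^ t) ^ 2 * (3 ^ t) ^ 1 := by
    rw [show (12 : ZMod p) = 2 ^ 2 * 3 ^ 1 by norm_num, mul_pow, pow_right_comm (2 : ZMod p),
      pow_right_comm (3 : ZMod p)]
  have p_24 : (24 : ZMod p) ^ t = (2 ^ t) ^ 3 * (3 ^ t) ^ 1 := by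
    rw [show (24 : ZMod p) = 2 ^ 3 * 3 ^ 1 by norm_num, mul_pow, pow_right_comm (2 : ZMod p),
      pow_right_comm (3 : ZMod p)]
  have p_18 : (18 : ZMod p) ^ t = (2 ^ t) ^ 1 * (3 ^ t) ^ 2 := by
    rw [show (18 : ZMod p) = 2 ^ 1 * 3 ^ 2 by norm_num, mul_pow, pow_right_comm (2 : ZMod p),
      pow_right_comm (3 : ZMod p)]
  have p_36 : (36 : ZMod p) ^ t = (2 ^ t) ^ 2 * (3 ^ t) ^ 2 := by
    rw [show (36 : ZMod p) = 2 ^ 2 * 3 ^ 2 by norm_num, mul_pow, pow_right_comm (2 : ZMod p),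
      pow_right_comm (3 : ZMod p)]
  have p_72 : (72 : ZMod p) ^ t = (2 ^ t) ^ 3 * (3 ^ t) ^ 2 := by
    rw [show (72 : ZMod p) = 2 ^ 3 * 3 ^ 2 by norm_num, mul_pow, pow_right_comm (2 : ZMod p),
      pow_right_comm (3 : ZMod p)]
  have p_108 : (108 : ZMod p) ^ t = (2 ^ t) ^ 2 * (3 ^ t) ^ 3 := by
    rw [show (108 : ZMod p) = 2 ^ 2 * 3 ^ 3 by norm_num, mul_pow, pow_right_comm (2 : ZMod p),
      pow_right_comm (3 : ZMod p)]
  rw [p_4, p_8, p_16, p_32, p_64, p_128, p_256, p_6, p_12, p_24, p_18, p_36, p_72, p_108]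
  generalize (2 : ZMod p) ^ t = a at *
  generalize (3 : ZMod p) ^ t = b at *
  -- Seven duplications lead from 1/12 down to 1/1536, whence the coefficient 256^t; they shed
  -- 11/24, 23/48, ..., 767/1536, which approach 1/2.
  have d_1_768 : P (1 / 768) = a * (P (1 / 1536) - P (767 / 1536)) := by
    have h := D 1 768 (by norm_num) (by norm_num) (by norm_num)
    norm_num at h
    exact h
  have d_1_384 : P (1 / 384) = a * (P (1 / 768) - P (383 / 768)) := by
    have h := D 1 384 (by norm_num) (by norm_num) (by norm_num)
    norm_num at h
    exact h
  have d_1_192 : P (1 / 192) = a * (P (1 / 384) - P (191 / 384)) := by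
    have h := D 1 192 (by norm_num) (by norm_num) (by norm_num)
    norm_num at h
    exact h
  have d_1_96 : P (1 / 96) = a * (P (1 / 192) - P (95 / 192)) := by
    have h := D 1 96 (by norm_num) (by norm_num) (by norm_num)
    norm_num at h
    exact h
  have d_1_48 : P (1 / 48) = a * (P (1 / 96) - P (47 / 96)) := by
    have h := D 1 48 (by norm_num) (by norm_num) (by norm_num)
    norm_num at h
    exact h
  have d_1_24 : P (1 / 24) = a * (P (1 / 48) - P (23 / 48)) := by
    have h := D 1 24 (by norm_num) (by norm_num) (by norm_num)
    norm_num at h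
    exact h
  have d_5_72 : P (5 / 72) = a * (P (5 / 144) - P (67 / 144)) := by
    have h := D 5 72 (by norm_num) (by norm_num) (by norm_num)
    norm_num at h
    exact h
  have d_11_144 : P (11 / 144) = a * (P (11 / 288) - P (133 / 288)) := by
    have h := D 11 144 (by norm_num) (by norm_num) (by norm_num)
    norm_num at h
    exact h
  have d_1_12 : P (1 / 12) = a * (P (1 / 24) - P (11 / 24)) := by
    have h := D 1 12 (by norm_num) (by norm_num) (by norm_num)
    norm_num at h
    exact h
  have d_13_72 : P (13 / 72) = a * (P (13 / 144) - P (59 / 144)) := by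
    have h := D 13 72 (by norm_num) (by norm_num) (by norm_num)
    norm_num at h
    exact h
  have d_7_36 : P (7 / 36) = a * (P (7 / 72) - P (29 / 72)) := by
    have h := D 7 36 (by norm_num) (by norm_num) (by norm_num)
    norm_num at h
    exact h
  have d_5_12 : P (5 / 12) = a * (P (5 / 24) - P (7 / 24)) := by
    have h := D 5 12 (by norm_num) (by norm_num) (by norm_num)
    norm_num at h
    exact h
  have d_11_24 : P (11 / 24) = a * (P (11 / 48) - P (13 / 48)) := by
    have h := D 11 24 (by norm_num) (by norm_num) (by norm_num)
    norm_num at h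
    exact h
  have d_17_36 : P (17 / 36) = a * (P (17 / 72) - P (19 / 72)) := by
    have h := D 17 36 (by norm_num) (by norm_num) (by norm_num)
    norm_num at h
    exact h
  have d_35_72 : P (35 / 72) = a * (P (35 / 144) - P (37 / 144)) := by
    have h := D 35 72 (by norm_num) (by norm_num) (by norm_num)
    norm_num at h
    exact h
  -- Triplication sends a point near 1/2 to another point near 1/2 and two points symmetric about
  -- 1/6, which is where the short intervals lie.
  have e_5_24 : P (5 / 24) = b * (P (5 / 72) + P (29 / 72) - P (19 / 72)) := by
    have h := T 5 24 (by norm_num) (by norm_num) (by norm_num)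
    norm_num at h
    exact h
  have e_11_48 : P (11 / 48) = b * (P (11 / 144) + P (59 / 144) - P (37 / 144)) := by
    have h := T 11 48 (by norm_num) (by norm_num) (by norm_num)
    norm_num at h
    exact h
  have e_13_48 : P (13 / 48) = b * (P (13 / 144) + P (61 / 144) - P (35 / 144)) := by
    have h := T 13 48 (by norm_num) (by norm_num) (by norm_num)
    norm_num at h
    exact h
  have e_7_24 : P (7 / 24) = b * (P (7 / 72) + P (31 / 72) - P (17 / 72)) := by
    have h := T 7 24 (by norm_num) (by norm_num) (by norm_num)
    norm_num at h
    exact h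
  have e_61_144 : P (61 / 144) = b * (P (61 / 432) + P (205 / 432) - P (83 / 432)) := by
    have h := T 61 144 (by norm_num) (by norm_num) (by norm_num)
    norm_num at h
    exact h
  have e_31_72 : P (31 / 72) = b * (P (31 / 216) + P (103 / 216) - P (41 / 216)) := by
    have h := T 31 72 (by norm_num) (by norm_num) (by norm_num)
    norm_num at h
    exact h
  have e_11_24 : P (11 / 24) = b * (P (11 / 72) + P (35 / 72) - P (13 / 72)) := by
    have h := T 11 24 (by norm_num) (by norm_num) (by norm_num)
    norm_num at h
    exact h
  have e_133_288 : P (133 / 288) = b * (P (133 / 864) + P (421 / 864) - P (155 / 864)) := by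
    have h := T 133 288 (by norm_num) (by norm_num) (by norm_num)
    norm_num at h
    exact h
  have e_67_144 : P (67 / 144) = b * (P (67 / 432) + P (211 / 432) - P (77 / 432)) := by
    have h := T 67 144 (by norm_num) (by norm_num) (by norm_num)
    norm_num at h
    exact h
  have e_17_36 : P (17 / 36) = b * (P (17 / 108) + P (53 / 108) - P (19 / 108)) := by
    have h := T 17 36 (by norm_num) (by norm_num) (by norm_num)
    norm_num at h
    exact h
  have e_205_432 : P (205 / 432) = b * (P (205 / 1296) + P (637 / 1296) - P (227 / 1296)) := by
    have h := T 205 432 (by norm_num) (by norm_num) (by norm_num)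
    norm_num at h
    exact h
  have e_103_216 : P (103 / 216) = b * (P (103 / 648) + P (319 / 648) - P (113 / 648)) := by
    have h := T 103 216 (by norm_num) (by norm_num) (by norm_num)
    norm_num at h
    exact h
  have e_23_48 : P (23 / 48) = b * (P (23 / 144) + P (71 / 144) - P (25 / 144)) := by
    have h := T 23 48 (by norm_num) (by norm_num) (by norm_num)
    norm_num at h
    exact h
  have e_35_72 : P (35 / 72) = b * (P (35 / 216) + P (107 / 216) - P (37 / 216)) := by
    have h := T 35 72 (by norm_num) (by norm_num) (by norm_num)
    norm_num at h
    exact h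
  clear D T
  -- The fractions 11/24, 17/36 and 35/72 are expanded both ways; equating their two expansions
  -- supplies relations beyond mere substitution.
  linear_combination (- a ^ 7 * b ^ 0) * d_1_768
    + (- a ^ 6 * b ^ 0) * d_1_384
    + (- a ^ 5 * b ^ 0) * d_1_192
    + (- a ^ 4 * b ^ 0) * d_1_96
    + (- a ^ 3 * b ^ 0) * d_1_48
    + (- a ^ 2 * b ^ 0) * d_1_24
    + (- a ^ 2 * b ^ 1) * d_5_72
    + (a ^ 2 * b ^ 1) * d_11_144
    + (- a ^ 1 * b ^ 0) * d_1_12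
    + (a ^ 1 * b ^ 1) * d_13_72
    + (- a ^ 1 * b ^ 1) * d_7_36
    + (- a ^ 1 * b ^ 0) * d_5_12
    + (a ^ 1 * b ^ 0) * d_11_24
    + (a ^ 1 * b ^ 1) * d_17_36
    + (- a ^ 1 * b ^ 1) * d_35_72
    + (- a ^ 2 * b ^ 0) * e_5_24
    + (a ^ 2 * b ^ 0) * e_11_48
    + (- a ^ 2 * b ^ 0) * e_13_48
    + (a ^ 2 * b ^ 0) * e_7_24
    + (- a ^ 2 * b ^ 1) * e_61_144
    + (a ^ 2 * b ^ 1) * e_31_72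
    + (- a ^ 1 * b ^ 0 + a ^ 2 * b ^ 0) * e_11_24
    + (- a ^ 3 * b ^ 1) * e_133_288
    + (a ^ 3 * b ^ 1) * e_67_144
    + (- a ^ 1 * b ^ 1) * e_17_36
    + (- a ^ 2 * b ^ 2) * e_205_432
    + (a ^ 2 * b ^ 2) * e_103_216
    + (a ^ 3 * b ^ 0) * e_23_48
    + (a ^ 1 * b ^ 0 + a ^ 1 * b ^ 1 - a ^ 2 * b ^ 0 - a ^ 3 * b ^ 0) * e_35_72

end Congruences

/-! ### From power sums to Euler numbers, and the exponent -2. -/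

section EulerCongruences

variable {p : ℕ} [Fact p.Prime]

/-- Since (p - 1) / 2 = t / 2 + k, the sign inside `signedEuler` cancels and only (-1)^k remains. -/
theorem eulerNumber_eq_powerSum_quarter (hp : p ≠ 2) {k t : ℕ} (hk : 0 < k) (ht0 : 0 < t)
    (htk : t + 2 * k = p - 1) :
    (-1 : ZMod p) ^ k * (eulerNumber t : ZMod p) =
      4 * (2 ^ t) ^ 2 * powerSum p t 0 (1 / 4) := by
  obtain ⟨m, hm⟩ := (Fact.out : p.Prime).odd_of_ne_two hp
  have ht : Even t := ⟨m - k, by omega⟩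
  rw [← signedEuler_eq_powerSum_quarter ht ht0 (by omega) hp, signedEuler,
    show (p - 1) / 2 = t / 2 + k by omega, pow_add]
  push_cast
  have hs : ((-1 : ZMod p) ^ (t / 2)) * (-1) ^ (t / 2) = 1 := by rw [← mul_pow]; norm_num
  linear_combination -(-1) ^ k * (eulerNumber t : ZMod p) * hs

theorem pow_mul_sq_pow_eq_one {n : ℕ} (hn : n.Coprime p) {k t : ℕ}
    (htk : t + 2 * k = p - 1) : (n : ZMod p) ^ t * ((n : ZMod p) ^ 2) ^ k = 1 := by
  rw [← pow_mul, ← pow_add, htk]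
  refine ZMod.pow_card_sub_one_eq_one fun h => ?_
  rw [ZMod.natCast_eq_zero_iff] at h
  exact (Nat.Prime.coprime_iff_not_dvd Fact.out).mp hn.symm h

/-- By Fermat, 2^t * 4^k = 1 and 3^t * 9^k = 1. The first reduces 4^(k-1) * 4 * (2^t)^2 to 2^t; the
second turns triplication at 1/4 into (9^k + 1) P(1/4) = P(1/12) + P(5/12). -/
theorem eulerNumber_eq_powerSum_twelfths (hp : 5 ≤ p) {k t : ℕ} (hk : 0 < k) (ht0 : 0 < t)
    (htk : t + 2 * k = p - 1) :
    (-1 : ZMod p) ^ k * 4 ^ (k - 1) * (9 ^ k + 1) * (eulerNumber t : ZMod p) =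
      2 ^ t * (powerSum p t 0 (1 / 12) + powerSum p t 0 (5 / 12)) := by
  obtain ⟨m, hm⟩ := (Fact.out : p.Prime).odd_of_ne_two (by omega)
  have ht : Even t := ⟨m - k, by omega⟩
  have hE := eulerNumber_eq_powerSum_quarter (p := p) (by omega) hk ht0 htk
  have hT := powerSum_triplication ht ht0 (by omega) (p := p) (by omega) (c := 1) (d := 4)
    (coprime_of_dvd_six_pow Fact.out hp (by norm_num)) (by norm_num) (by norm_num)
  norm_num at hT
  have h2 := pow_mul_sq_pow_eq_one (p := p) (n := 2)
    (coprime_of_dvd_six_pow Fact.out hp (by norm_num)) htk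
  have h3 := pow_mul_sq_pow_eq_one (p := p) (n := 3)
    (coprime_of_dvd_six_pow Fact.out hp (by norm_num)) htk
  norm_num at h2 h3
  have h4 : (4 : ZMod p) ^ k = 4 ^ (k - 1) * 4 := by rw [← pow_succ, Nat.sub_add_cancel hk]
  rw [h4] at h2
  linear_combination 4 ^ (k - 1) * (9 ^ k + 1) * hE
    + 2 ^ t * (9 ^ k + 1) * powerSum p t 0 (1 / 4) * h2 + 2 ^ t * 9 ^ k * hT
    - 2 ^ t * (powerSum p t 0 (1 / 4) - powerSum p t 0 (1 / 12) - powerSum p t 0 (5 / 12)) * h3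

theorem powerSum_neg_two (hp : 5 ≤ p) (x y : ℝ) :
    powerSum p (-2) x y = powerSum p (p - 3 : ℕ) x y := by
  unfold powerSum
  refine Finset.sum_congr rfl fun s _ => ?_
  rw [zpow_natCast]
  rcases eq_or_ne (s : ZMod p) 0 with h | h
  -- At a multiple of p both sides are 0, because 0 ^ (-2) = 0 by convention.
  · rw [h, zero_pow (by omega), zero_zpow _ (by norm_num)]
  · have h1 := ZMod.pow_card_sub_one_eq_one h
    rw [show p - 1 = p - 3 + 2 by omega, pow_add] at h1
    rw [eq_comm, zpow_neg]
    exact eq_inv_of_mul_eq_one_left (by exact_mod_cast h1)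

/-- The constant 47775744 = 2^16 * 3^6 is the least common multiple of the squares of the bases 2,
4, ..., 256, 6, ..., 108. By Fermat n^(p-3) = n^(-2), so multiplying by it makes every coefficient
the explicit integer 47775744 / n^2, or a signed sum of these. -/
theorem combination_eulerTermsVandiver (hp : 5 ≤ p) :
    combination p (-2) eulerTermsVandiver =
      -47775744 * combination p (p - 3 : ℕ) (eulerTerms (p - 3)) := by
  have hM : (47775744 : ZMod p) ≠ 0 := by
    intro h
    have h' : p ∣ 47775744 := (ZMod.natCast_eq_zero_iff _ p).mp (by exact_mod_cast h)
    have hP : p.Prime := Fact.out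
    rw [show 47775744 = 6 ^ 6 * 2 ^ 10 by norm_num] at h'
    have h6 := (coprime_of_dvd_six_pow hP hp (show 6 ^ 6 ∣ 6 ^ 9 by norm_num))
    have h2 := (coprime_of_dvd_six_pow hP hp (show 2 ∣ 6 ^ 9 by norm_num)).pow_left 10
    exact (hP.coprime_iff_not_dvd.mp (h6.mul_left h2).symm) h'
  have h : ∀ n q : ℕ, n ∣ 6 ^ 9 → n ^ 2 * q = 47775744 →
      (n : ZMod p) ^ (p - 3) = q * (47775744 : ZMod p)⁻¹ := by
    intro n q hn hq
    have h1 := pow_mul_sq_pow_eq_one (p := p) (coprime_of_dvd_six_pow Fact.out hp hn)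
      (show p - 3 + 2 * 1 = p - 1 by omega)
    have hq' : (n : ZMod p) ^ 2 * q = 47775744 := by exact_mod_cast congrArg (Nat.cast) hq
    rw [eq_mul_inv_iff_mul_eq₀ hM, ← hq']
    linear_combination (q : ZMod p) * h1
  have p_2 := h 2 11943936 (by norm_num) (by norm_num)
  have p_4 := h 4 2985984 (by norm_num) (by norm_num)
  have p_8 := h 8 746496 (by norm_num) (by norm_num)
  have p_16 := h 16 186624 (by norm_num) (by norm_num)
  have p_32 := h 32 46656 (by norm_num) (by norm_num)
  have p_64 := h 64 11664 (by norm_num) (by norm_num)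
  have p_128 := h 128 2916 (by norm_num) (by norm_num)
  have p_256 := h 256 729 (by norm_num) (by norm_num)
  have p_6 := h 6 1327104 (by norm_num) (by norm_num)
  have p_12 := h 12 331776 (by norm_num) (by norm_num)
  have p_24 := h 24 82944 (by norm_num) (by norm_num)
  have p_18 := h 18 147456 (by norm_num) (by norm_num)
  have p_36 := h 36 36864 (by norm_num) (by norm_num)
  have p_72 := h 72 9216 (by norm_num) (by norm_num)
  have p_108 := h 108 4096 (by norm_num) (by norm_num)
  push_cast at p_2 p_4 p_8 p_16 p_32 p_64 p_128 p_256 p_6 p_12 p_24 p_18 p_36 p_72 p_108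
  suffices hc : combination p (p - 3 : ℕ) (eulerTerms (p - 3)) =
      -(47775744 : ZMod p)⁻¹ * combination p (p - 3 : ℕ) eulerTermsVandiver by
    rw [hc, ← mul_assoc, neg_mul_neg, mul_inv_cancel₀ hM, one_mul]
    simp only [combination, powerSum_neg_two hp]
  simp only [combination, eulerTerms, eulerTermsVandiver, List.map_cons, List.map_nil,
    List.sum_cons, List.sum_nil]
  generalize powerSum p (p - 3 : ℕ) = S
  push_cast
  rw [p_2, p_4, p_8, p_16, p_32, p_64, p_128, p_256, p_6, p_12, p_24, p_18, p_36, p_72, p_108]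
  ring

theorem cost_eulerTerms (p t : ℕ) : cost p (eulerTerms t) = 27 * (p : ℝ) / 512 := by
  simp only [cost, eulerTerms, List.map_cons, List.map_nil, List.sum_cons, List.sum_nil]
  ring

theorem cost_eulerTermsVandiver (p : ℕ) : cost p eulerTermsVandiver = 27 * (p : ℝ) / 512 := by
  simp only [cost, eulerTermsVandiver, List.map_cons, List.map_nil, List.sum_cons, List.sum_nil]
  ring

end EulerCongruences

theorem mainTheorem4 :
    (∀ (p : ℕ) [Fact p.Prime] (k t : ℕ), 5 ≤ p → 1 ≤ k → 2 * k ≤ p - 3 → t = p - 1 - 2 * k →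
      ¬ p ∣ 9 ^ k + 1 →
        (-1 : ZMod p) ^ k * 4 ^ (k - 1) * (9 ^ k + 1) * (eulerNumber t : ZMod p) =
            2 ^ t * (powerSum p t 0 (1 / 12) - powerSum p t (5 / 12) (1 / 2)) ∧
        (-1 : ZMod p) ^ k * 4 ^ (k - 1) * (9 ^ k + 1) * (eulerNumber t : ZMod p) =
            combination p t (eulerTerms t) ∧
        (eulerTerms t).length = 33 ∧
        cost p (eulerTerms t) = 27 * (p : ℝ) / 512 ∧
        27 * (p : ℝ) / 512 < (p : ℝ) / 18.96) ∧
    (∀ (p : ℕ) [Fact p.Prime], 7 ≤ p →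
        (477757440 : ZMod p) * (eulerNumber (p - 3) : ZMod p) =
            combination p (-2) eulerTermsVandiver ∧
        eulerTermsVandiver.length = 33 ∧
        cost p eulerTermsVandiver = 27 * (p : ℝ) / 512) := by
  refine ⟨?_, ?_⟩
  · intro p _ k t hp hk hkp ht _
    obtain ⟨m, hm⟩ := (Fact.out : p.Prime).odd_of_ne_two (by omega)
    have ht0 : 0 < t := by omega
    have htk : t + 2 * k = p - 1 := by omega
    have hev : Even t := ⟨m - k, by omega⟩
    have h := eulerNumber_eq_powerSum_twelfths hp hk ht0 htk
    refine ⟨?_, ?_, rfl, cost_eulerTerms p t, ?_⟩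
    · have hs := powerSum_add t (p := p) (x := 0) (y := 5 / 12) (z := 1 / 2) (by norm_num)
        (by norm_num) (by
          exact_mod_cast div_mul_ne_intCast (c := 5) (d := 12)
            (coprime_of_dvd_six_pow Fact.out hp (by norm_num)) (by norm_num) (by norm_num))
      rw [powerSum_zero_half hev ht0 (by omega) (by omega)] at hs
      linear_combination h + 2 ^ t * hs
    · rw [h, combination_eulerTerms hp hev ht0 (by omega)]
    · have hp0 : (0 : ℝ) < p := by exact_mod_cast (by omega : 0 < p)
      -- The margin is thin: 27 * 18.96 = 511.92 < 512.
      norm_num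
      linarith
  · intro p _ hp
    obtain ⟨m, hm⟩ := (Fact.out : p.Prime).odd_of_ne_two (by omega)
    refine ⟨?_, rfl, cost_eulerTermsVandiver p⟩
    -- For k = 1 the factor on the Euler number is -(9 + 1) = -10, and 477757440 = 10 * 47775744.
    have h := eulerNumber_eq_powerSum_twelfths (p := p) (k := 1) (t := p - 3) (by omega)
      one_pos (by omega) (by omega)
    rw [combination_eulerTermsVandiver (by omega),
      combination_eulerTerms (by omega) ⟨m - 1, by omega⟩ (by omega) (by omega), ← h]
    ring
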